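/- Words are over $\{a,b\}$; $\mathcal P_w$ denotes the Parikh vector of a finite word $w$ (the number of occurrences of each letter) and $|\mathcal P|$ the sum of the components of $\mathcal P$. Write $\mathcal P\subset\mathcal Q$ if $|\mathcal P|<|\mathcal Q|$ and $\mathcal P\le\mathcal Q$ componentwise. An abelian decomposition of period $m$ of $w$ is a factorization $w=u_0u_1\cdots u_{j-1}u_j$, $j\ge 2$, such that $u_1,\dots,u_{j-1}$ have a common Parikh vector $\mathcal P$ with $|\mathcal P|=m$ and $\mathcal P_{u_0},\mathcal P_{u_j}\subset\mathcal P$. If $u_0$ and $u_j$ can be chosen empty, $w$ is an abelian power of period $m$; if $j\ge 3$ can be chosen, $w$ is an abelian repetition of period $m$; in both cases its exponent is $|w|/m$. For an infinite word $s$, let $k_m$ (resp. $k'_m$) be the maximum exponent (supremum in $[0,\infty]$) of an abelian power (resp. abelian repetition) of period $m$ that is a factor of $s$. The abelian critical exponent of $s$ is $A(s)=\limsup_{m\to\infty}k_m/m\in[0,\infty]$. Let $\alpha\in[0,1)$ be irrational and $\rho\in[0,1)$. A Sturmian word of angle $\alpha$ and initial point $\rho$ is the infinite word $a_0a_1a_2\cdots$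 with $a_n=b$ if $\{\rho+n\alpha\}\in I_b$ and $a_n=a$ otherwise, where either $I_b=[0,1-\alpha)$ or $I_b=(0,1-\alpha]$. Let $\phi=(1+\sqrt5)/2$; the Fibonacci word is the Sturmian word with $\alpha=\rho=\phi-1$. Two real numbers with continued fraction expansions $[a_0;a_1,a_2,\dots]$ and $[b_0;b_1,b_2,\dots]$ are equivalent if there are integers $N,M\ge 0$ with $a_{N+i}=b_{M+i}$ for all $i\ge 0$. **Theorem.** For every Sturmian word $s_\alpha$ of angle $\alpha$ (and any initial point), $A(s_\alpha)=\limsup_{m\to\infty}k_m/m=\limsup_{m\to\infty}k'_m/m$ and $A(s_\alpha)\ge\sqrt5$. Moreover, $A(s_\alpha)=\sqrt5$ if and only if $\alpha$ is equivalent to $\phi-1$, that is, if and only if the partial quotients of $\alpha$ are eventually all equal to $1$. In particular, the abelian critical exponent of the Fibonacci word is $\sqrt5$. -/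

import Mathlib

open scoped ENNReal

namespace AbelianSturmian

/-! ### Parikh vectors, abelian powers and abelian repetitions -/

section Words

variable {A : Type*} [Fintype A] [DecidableEq A]

/-- The Parikh vector of a finite word: the number of occurrences of each letter. -/
def parikh (w : List A) : A → ℕ := fun a => w.count a

/-- The norm of a Parikh vector: the sum of its components. -/
def parikhNorm (P : A → ℕ) : ℕ := ∑ a, P a

/-- `P` is contained in `Q`: component-wise at most `Q`, and of strictly smaller norm. -/
def ParikhContained (P Q : A → ℕ) : Prop :=
  parikhNorm P < parikhNorm Q ∧ ∀ a, P a ≤ Q a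

/-- `w = u₀ u₁ ⋯ u_{j-1} u_j` with `j ≥ 2` is an abelian decomposition of `w` with abelian period
`m`; here `head = u₀`, `blocks = [u₁, …, u_{j-1}]` and `tail = u_j`. -/
def IsAbelianDecomposition (w : List A) (m : ℕ) (head : List A) (blocks : List (List A))
    (tail : List A) : Prop :=
  w = head ++ blocks.flatten ++ tail ∧ 1 ≤ blocks.length ∧
    ∃ P : A → ℕ, parikhNorm P = m ∧ (∀ u ∈ blocks, parikh u = P) ∧
      ParikhContained (parikh head) P ∧ ParikhContained (parikh tail) P

/-- `w` is an abelian power of period `m` (possibly degenerated, that is, of exponent `1`): it has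
an abelian decomposition of period `m` with empty head and empty tail. -/
def IsAbelianPower (w : List A) (m : ℕ) : Prop :=
  ∃ blocks : List (List A), IsAbelianDecomposition w m [] blocks []

/-- `w` is an abelian repetition of period `m`: it has an abelian decomposition
`u₀ u₁ ⋯ u_{j-1} u_j` of period `m` with `j ≥ 3`. -/
def IsAbelianRepetition (w : List A) (m : ℕ) : Prop :=
  ∃ (head : List A) (blocks : List (List A)) (tail : List A),
    IsAbelianDecomposition w m head blocks tail ∧ 2 ≤ blocks.length

/-- The factor of length `l` of the infinite word `s` occurring at position `n`. -/
def factorAt (s : ℕ → A) (n l : ℕ) : List A := (List.range l).map fun i => s (n + i)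

/-- `w` is a factor of the infinite word `s`. -/
def IsFactor (w : List A) (s : ℕ → A) : Prop := ∃ n, w = factorAt s n w.length

/-- The exponent `|w| / m` of an abelian power or abelian repetition `w` of period `m`. -/
noncomputable def exponent (w : List A) (m : ℕ) : ℝ≥0∞ := (w.length : ℝ≥0∞) / (m : ℝ≥0∞)

/-- `k_m`: the maximum (supremum in `[0, ∞]`) of the exponents of the abelian powers of period `m`
that are factors of `s`. -/
noncomputable def maxPowerExponent (s : ℕ → A) (m : ℕ) : ℝ≥0∞ :=
  sSup {k | ∃ w : List A, IsFactor w s ∧ IsAbelianPower w m ∧ k = exponent w m}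

/-- `k'_m`: the maximum (supremum in `[0, ∞]`) of the exponents of the abelian repetitions of
period `m` that are factors of `s`. -/
noncomputable def maxRepetitionExponent (s : ℕ → A) (m : ℕ) : ℝ≥0∞ :=
  sSup {k | ∃ w : List A, IsFactor w s ∧ IsAbelianRepetition w m ∧ k = exponent w m}

/-- The abelian critical exponent `limsup k_m / m`, an element of `[0, ∞]`. -/
noncomputable def abelianCriticalExponent (s : ℕ → A) : ℝ≥0∞ :=
  Filter.limsup (fun m : ℕ => maxPowerExponent s m / (m : ℝ≥0∞)) Filter.atTop

/-- The variant `limsup k'_m / m`, computed with abelian repetitions. -/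
noncomputable def abelianCriticalExponent' (s : ℕ → A) : ℝ≥0∞ :=
  Filter.limsup (fun m : ℕ => maxRepetitionExponent s m / (m : ℝ≥0∞)) Filter.atTop

end Words

/-! ### Sturmian words as codings of rotations -/

/-- The binary alphabet. -/
inductive Letter
  | a
  | b
  deriving DecidableEq

instance : Fintype Letter := ⟨{Letter.a, Letter.b}, fun x => by cases x <;> decide⟩

open Classical in
/-- The coding of the rotation by `α` of the point `ρ` with respect to the intervals
`I_b = [0, 1 - α)` and `I_a = [1 - α, 1)`. -/
noncomputable def lowerSturmian (α ρ : ℝ) : ℕ → Letter := fun n =>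
  if Int.fract (ρ + n * α) ∈ Set.Ico 0 (1 - α) then Letter.b else Letter.a

open Classical in
/-- The coding of the rotation by `α` of the point `ρ` with respect to the intervals
`I_b = (0, 1 - α]` and `I_a = (1 - α, 1]`, where the points `0` and `1` of the torus are
identified, so that `0` belongs to `I_a`. -/
noncomputable def upperSturmian (α ρ : ℝ) : ℕ → Letter := fun n =>
  if Int.fract (ρ + n * α) ∈ Set.Ioc 0 (1 - α) then Letter.b else Letter.a

/-- `s` is a Sturmian word of angle `α` and initial point `ρ`. -/
def IsSturmianWord (α ρ : ℝ) (s : ℕ → Letter) : Prop :=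
  Irrational α ∧ α ∈ Set.Ico (0 : ℝ) 1 ∧ ρ ∈ Set.Ico (0 : ℝ) 1 ∧
    (s = lowerSturmian α ρ ∨ s = upperSturmian α ρ)

/-- The Fibonacci word: the Sturmian word of angle and initial point `φ - 1`. (No point of the orbit
is an endpoint of the coding intervals, so both codings give the same word.) -/
noncomputable def fibonacciWord : ℕ → Letter :=
  lowerSturmian (Real.goldenRatio - 1) (Real.goldenRatio - 1)

/-! ### Equivalence of real numbers through their continued fractions -/

/-- The `n`-th partial quotient `a_n` of the simple continued fraction expansion
`[a₀; a₁, a₂, …]` of `x`; it is `none` if the expansion terminates before `a_n`. -/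
noncomputable def partialQuotient (x : ℝ) : ℕ → Option ℝ
  | 0 => some (GenContFract.of x).h
  | n + 1 => (GenContFract.of x).partDens.get? n

/-- Two real numbers are equivalent if their continued fraction expansions ultimately coincide. -/
def CFEquivalent (x y : ℝ) : Prop :=
  ∃ N M : ℕ, ∀ i : ℕ, partialQuotient x (N + i) = partialQuotient y (M + i)

end AbelianSturmian

namespace AbelianSturmian

/-! ### Continued fractions -/

/-! Write ‖y‖ for the distance from y to the nearest integer. The number of letters `a` in a factor
of a Sturmian word is a difference of values of ⌊ρ + nα⌋ (or of the ceiling), hence within 1 of α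
times its length. So k consecutive blocks of length m with equal Parikh vectors force k‖mα‖ < 1
(`maxPowerExponent_le`). Conversely, if k‖mα‖ < 1, density of the orbit gives a starting point from
which k steps of length m cross no integer beyond the k multiples of `round (m * α)`
(`le_maxPowerExponent_of_mul_lt_one`). Thus k_m is 1/‖mα‖ up to 1, and A(s) is the Lagrange constant
limsup 1/(m‖mα‖). Since k'_m differs from k_m by a bounded amount, it gives the same limsup.

What remains is Hurwitz's theorem with its equality case. At a convergent denominator q with
predecessor q' and next complete quotient z, 1/|qα - p| = qz + q'. If infinitely many partial
quotients are at least 2, this gives a constant of at least 8/3 > √5 (`frequentlyApprox_of_two_le`).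
Otherwise the complete quotients are eventually φ: convergents give √5 from below, and the norm form
of ℤ[φ] gives √5 from above (`exists_le_distInt_of_eventually_one`). -/

/-- The complete quotients of the continued fraction expansion of `x`. -/
noncomputable def completeQuotient (x : ℝ) : ℕ → ℝ
  | 0 => x
  | n + 1 => (Int.fract (completeQuotient x n))⁻¹

/-- The denominators of the convergents of `x`, preceded by `0`. -/
noncomputable def convDen (x : ℝ) : ℕ → ℤ
  | 0 => 0
  | 1 => 1
  | n + 2 => ⌊completeQuotient x (n + 1)⌋ * convDen x (n + 1) + convDen x n

/-- The numerators of the convergents of `x`, preceded by `1`. -/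
noncomputable def convNum (x : ℝ) : ℕ → ℤ
  | 0 => 1
  | 1 => ⌊x⌋
  | n + 2 => ⌊completeQuotient x (n + 1)⌋ * convNum x (n + 1) + convNum x n

variable {x : ℝ}

theorem irrational_fract (hx : Irrational x) : Irrational (Int.fract x) := by
  rw [Int.fract]; exact hx.sub_intCast _

theorem irrational_completeQuotient (hx : Irrational x) (n : ℕ) :
    Irrational (completeQuotient x n) := by
  induction n with
  | zero => exact hx
  | succ n ih => exact (irrational_fract ih).inv

theorem fract_completeQuotient_pos (hx : Irrational x) (n : ℕ) :
    0 < Int.fract (completeQuotient x n) :=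
  lt_of_le_of_ne (Int.fract_nonneg _)
    (irrational_fract (irrational_completeQuotient hx n)).ne_zero.symm

theorem one_lt_completeQuotient_succ (hx : Irrational x) (n : ℕ) :
    1 < completeQuotient x (n + 1) :=
  (one_lt_inv₀ (fract_completeQuotient_pos hx n)).2 (Int.fract_lt_one _)

theorem one_le_floor_completeQuotient_succ (hx : Irrational x) (n : ℕ) :
    1 ≤ ⌊completeQuotient x (n + 1)⌋ :=
  Int.le_floor.2 (by exact_mod_cast (one_lt_completeQuotient_succ hx n).le)

theorem completeQuotient_eq (n : ℕ) :
    completeQuotient x n = ⌊completeQuotient x n⌋ + (completeQuotient x (n + 1))⁻¹ := by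
  rw [completeQuotient, inv_inv, Int.floor_add_fract]

/-- Irrationality keeps every fractional part nonzero, so the Mathlib expansion never terminates and
follows the recursion of `completeQuotient`. -/
theorem stream_eq (hx : Irrational x) (n : ℕ) :
    GenContFract.IntFractPair.stream x n =
      some (GenContFract.IntFractPair.of (completeQuotient x n)) := by
  induction n with
  | zero => rfl
  | succ n ih =>
    exact GenContFract.IntFractPair.stream_succ_of_some ih (fract_completeQuotient_pos hx n).ne'

theorem partialQuotient_eq (hx : Irrational x) (n : ℕ) :
    partialQuotient x n = some (⌊completeQuotient x n⌋ : ℝ) := by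
  cases n with
  | zero => rfl
  | succ n =>
    rw [partialQuotient]
    exact GenContFract.partDen_eq_s_b
      (GenContFract.get?_of_eq_some_of_succ_get?_intFractPair_stream (stream_eq hx (n + 1)))

theorem convDen_bounds (hx : Irrational x) (n : ℕ) :
    0 ≤ convDen x n ∧ (n : ℤ) ≤ convDen x (n + 1) ∧ 1 ≤ convDen x (n + 1) := by
  -- The induction needs positivity of the earlier denominator, which fails only at index 0. The
  -- linear lower bound later makes denominators exceed any given N.
  have key : (n = 0 ∧ convDen x n = 0 ∨ 1 ≤ convDen x n) ∧ (n : ℤ) ≤ convDen x (n + 1) ∧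
      1 ≤ convDen x (n + 1) := by
    induction n with
    | zero => simp [convDen]
    | succ n ih =>
      obtain ⟨h0, h1, h2⟩ := ih
      have ha := one_le_floor_completeQuotient_succ hx n
      have h3 : convDen x (n + 1) ≤ ⌊completeQuotient x (n + 1)⌋ * convDen x (n + 1) :=
        le_mul_of_one_le_left (by omega) ha
      rw [convDen]
      push_cast
      omega
  omega

theorem convDen_le_succ (hx : Irrational x) (n : ℕ) : convDen x n ≤ convDen x (n + 1) := by
  cases n with
  | zero => simp [convDen]
  | succ n =>
    have h3 : convDen x (n + 1) ≤ ⌊completeQuotient x (n + 1)⌋ * convDen x (n + 1) :=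
      le_mul_of_one_le_left (by linarith [(convDen_bounds hx n).2.2])
        (one_le_floor_completeQuotient_succ hx n)
    rw [convDen]
    linarith [(convDen_bounds hx n).1]

theorem det_conv (x : ℝ) (n : ℕ) :
    convNum x (n + 1) * convDen x n - convNum x n * convDen x (n + 1) = (-1) ^ (n + 1) := by
  induction n with
  | zero => simp [convNum, convDen]
  | succ n ih =>
    rw [convNum, convDen, pow_succ, ← ih]
    ring

/-- This is x = (pz + p')/(qz + q') with the denominator cleared. The induction substitutes z = ⌊z⌋
+ 1/y, where y is the next complete quotient. -/
theorem mul_conv_eq (hx : Irrational x) (n : ℕ) :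
    x * (convDen x (n + 1) * completeQuotient x (n + 1) + convDen x n) =
      convNum x (n + 1) * completeQuotient x (n + 1) + convNum x n := by
  induction n with
  | zero =>
    have h := completeQuotient_eq (x := x) 0
    have h1 := one_lt_completeQuotient_succ hx 0
    simp only [convDen, convNum]
    simp only [completeQuotient] at h h1 ⊢
    have h2 : Int.fract x ≠ 0 := (fract_completeQuotient_pos hx 0).ne'
    push_cast
    field_simp
    linarith [Int.floor_add_fract x]
  | succ n ih =>
    have h := completeQuotient_eq (x := x) (n + 1)
    have h1 := one_lt_completeQuotient_succ hx (n + 1)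
    have h2 : completeQuotient x (n + 2) ≠ 0 := by linarith
    rw [convDen, convNum]
    push_cast
    set y := completeQuotient x (n + 2)
    set z := completeQuotient x (n + 1)
    have h3 : z * y = ⌊z⌋ * y + 1 := by
      nth_rw 1 [h]
      rw [add_mul, inv_mul_cancel₀ h2]
    linear_combination y * ih + (convNum x (n + 1) - x * convDen x (n + 1)) * h3

/-- Multiplying `mul_conv_eq` by q leaves only the determinant pq' - p'q = ±1. -/
theorem abs_mul_sub_conv (hx : Irrational x) (n : ℕ) :
    |convDen x (n + 1) * x - convNum x (n + 1)| *
      (convDen x (n + 1) * completeQuotient x (n + 1) + convDen x n) = 1 := by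
  have h1 := one_lt_completeQuotient_succ hx n
  obtain ⟨h2, -, h3⟩ := convDen_bounds hx n
  have hpos : (0 : ℝ) ≤
      convDen x (n + 1) * completeQuotient x (n + 1) + convDen x n := by
    have : (0 : ℝ) ≤ convDen x n := by exact_mod_cast h2
    have : (1 : ℝ) ≤ convDen x (n + 1) := by exact_mod_cast h3
    positivity
  have hd : (convNum x (n + 1) * convDen x n - convNum x n * convDen x (n + 1) : ℝ) =
      (-1) ^ (n + 1) := by exact_mod_cast det_conv x n
  have : (convDen x (n + 1) * x - convNum x (n + 1)) *
      (convDen x (n + 1) * completeQuotient x (n + 1) + convDen x n) = -(-1) ^ (n + 1) := by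
    linear_combination (convDen x (n + 1) : ℝ) * mul_conv_eq hx n - hd
  calc _ = |(convDen x (n + 1) * x - convNum x (n + 1)) *
      (convDen x (n + 1) * completeQuotient x (n + 1) + convDen x n)| := by
        rw [abs_mul, abs_of_nonneg hpos]
    _ = 1 := by rw [this, abs_neg, abs_pow, abs_neg, abs_one, one_pow]

/-! ### Approximation constants -/

/-- The distance of `x` to the nearest integer. -/
noncomputable def distInt (x : ℝ) : ℝ := |x - round x|

theorem distInt_pos (hx : Irrational x) {m : ℕ} (hm : 0 < m) : 0 < distInt (m * x) := by
  rw [distInt, abs_pos, sub_ne_zero]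
  exact (hx.natCast_mul hm.ne').ne_int _

theorem distInt_le_half (x : ℝ) : distInt x ≤ 1 / 2 := abs_sub_round x

/-- The numbers `1 / (m ‖m x‖)` are frequently at least `c`. -/
def FrequentlyApprox (x c : ℝ) : Prop :=
  ∀ N : ℕ, ∃ m : ℕ, N ≤ m ∧ 0 < m ∧ c * (m * distInt (m * x)) ≤ 1

theorem FrequentlyApprox.of_convergents (hx : Irrational x) {c : ℝ}
    (h : ∀ N : ℕ, ∃ n, N ≤ n ∧ c * convDen x (n + 1) ≤
      convDen x (n + 1) * completeQuotient x (n + 1) + convDen x n) :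
    FrequentlyApprox x c := by
  intro N
  obtain ⟨n, hn, h⟩ := h N
  obtain ⟨h2, h1, h3⟩ := convDen_bounds hx n
  lift convDen x (n + 1) to ℕ using (by omega) with m hm
  refine ⟨m, by omega, by omega, ?_⟩
  have h4 := abs_mul_sub_conv hx n
  rw [← hm] at h4
  have h5 : distInt (m * x) ≤ |m * x - convNum x (n + 1)| := round_le _ _
  push_cast at h h4
  have h6 : 0 ≤ distInt (m * x) := abs_nonneg _
  set D := (m * completeQuotient x (n + 1) + convDen x n : ℝ)
  rcases le_or_gt 0 c with hc | hc
  · calc c * (m * distInt (m * x)) ≤ |m * x - convNum x (n + 1)| * (c * m) := by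
          rw [← mul_assoc, mul_comm]
          gcongr
      _ ≤ |m * x - convNum x (n + 1)| * D := by gcongr
      _ = 1 := h4
  · have : 0 ≤ (m * distInt (m * x)) := by positivity
    nlinarith

theorem frequentlyApprox_of_two_le (hx : Irrational x)
    (h : ∀ N : ℕ, ∃ n, N ≤ n ∧ 2 ≤ ⌊completeQuotient x n⌋) :
    FrequentlyApprox x (8 / 3) := by
  apply FrequentlyApprox.of_convergents hx
  intro N
  have hQ : ∀ n, (0 : ℝ) ≤ convDen x n ∧ (1 : ℝ) ≤ convDen x (n + 1) := fun n => by
    obtain ⟨h2, -, h3⟩ := convDen_bounds hx n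
    exact ⟨by exact_mod_cast h2, by exact_mod_cast h3⟩
  -- A late partial quotient of at least 3 already suffices. Otherwise a late quotient 2 has
  -- neighbours at most 2, so z ≥ 2 + 1/3 and q'/q ≥ 1/3, whence 8/3.
  by_cases h3 : ∃ n, N ≤ n ∧ 3 ≤ ⌊completeQuotient x (n + 1)⌋
  · obtain ⟨n, hn, h3⟩ := h3
    refine ⟨n, hn, ?_⟩
    have h4 : (3 : ℝ) ≤ completeQuotient x (n + 1) := by exact_mod_cast Int.le_floor.1 h3
    nlinarith [hQ n]
  · push Not at h3
    obtain ⟨n, hn, h2⟩ := h (N + 2)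
    obtain ⟨n, rfl⟩ := Nat.exists_eq_add_of_le' (show 2 ≤ n by omega)
    refine ⟨n + 1, by omega, ?_⟩
    have h4 : (2 : ℝ) ≤ ⌊completeQuotient x (n + 2)⌋ := by exact_mod_cast h2
    have h5 : completeQuotient x (n + 3) < 3 := by
      have := h3 (n + 2) (by omega)
      exact_mod_cast Int.floor_lt.1 this
    have h6 : (⌊completeQuotient x (n + 1)⌋ : ℝ) ≤ 2 := by
      have := h3 n (by omega)
      exact_mod_cast (by omega : ⌊completeQuotient x (n + 1)⌋ ≤ 2)
    have h7 : (1 / 3 : ℝ) ≤ (completeQuotient x (n + 3))⁻¹ := by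
      rw [one_div]
      exact inv_anti₀ (by linarith [one_lt_completeQuotient_succ hx (n + 2)]) h5.le
    have h8 : (7 / 3 : ℝ) ≤ completeQuotient x (n + 2) := by
      rw [completeQuotient_eq (n + 2)]; linarith
    have h9 : (convDen x n : ℝ) ≤ convDen x (n + 1) := by exact_mod_cast convDen_le_succ hx n
    have h10 : (convDen x (n + 2) : ℝ) ≤ 3 * convDen x (n + 1) := by
      rw [convDen]
      push_cast
      nlinarith [hQ n]
    nlinarith [hQ (n + 1)]

theorem goldenRatio_mul_sub_one : Real.goldenRatio * (Real.goldenRatio - 1) = 1 := by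
  linear_combination Real.goldenRatio_sq

/-- The map inverse to y ↦ 1 + 1/y expands distances to its fixed point φ by a factor of at least φ
along the orbit. All later quotients lie in [1, 2), within 1 of φ, so the initial distance must
vanish. -/
theorem completeQuotient_eq_goldenRatio (hx : Irrational x) {N : ℕ}
    (h : ∀ n, N ≤ n → ⌊completeQuotient x n⌋ = 1) {n : ℕ} (hn : N ≤ n) :
    completeQuotient x n = Real.goldenRatio := by
  set φ := Real.goldenRatio
  have hφ : 1 < φ := Real.one_lt_goldenRatio
  have hφ' : φ * (φ - 1) = 1 := goldenRatio_mul_sub_one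
  have step : ∀ k, N ≤ k → φ * |completeQuotient x k - φ| ≤ |completeQuotient x (k + 1) - φ| := by
    intro k hk
    have h1 := one_lt_completeQuotient_succ hx k
    have h2 := completeQuotient_eq (x := x) k
    rw [h k hk] at h2
    set y := completeQuotient x (k + 1)
    have h3 : y * y⁻¹ = 1 := mul_inv_cancel₀ (by linarith)
    have h4 : y - φ = -(y * (φ * (completeQuotient x k - φ))) := by
      rw [h2]
      push_cast
      linear_combination -y * hφ' + φ * h3
    rw [h4, abs_neg, abs_mul, abs_mul, abs_of_pos (by linarith : 0 < y),
      abs_of_pos (by linarith : 0 < φ)]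
    exact le_mul_of_one_le_left (by positivity) h1.le
  have step' : ∀ k, φ ^ k * |completeQuotient x n - φ| ≤ |completeQuotient x (n + k) - φ| := by
    intro k
    induction k with
    | zero => simp
    | succ k ih =>
      calc φ ^ (k + 1) * |completeQuotient x n - φ|
          = φ * (φ ^ k * |completeQuotient x n - φ|) := by ring
        _ ≤ φ * |completeQuotient x (n + k) - φ| := by gcongr
        _ ≤ _ := step _ (by omega)
  by_contra hne
  have hpos : 0 < |completeQuotient x n - φ| := abs_pos.2 (sub_ne_zero.2 hne)
  obtain ⟨k, hk⟩ := pow_unbounded_of_one_lt (1 / |completeQuotient x n - φ|) hφ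
  rw [div_lt_iff₀ hpos] at hk
  have h5 := h (n + k) (by omega)
  rw [Int.floor_eq_iff] at h5
  have h6 : |completeQuotient x (n + k) - φ| < 1 := by
    have := Real.goldenRatio_lt_two
    push_cast at h5
    rw [abs_lt]
    constructor <;> linarith
  linarith [step' k]

theorem frequentlyApprox_sqrt_five_of_eventually_one (hx : Irrational x) {N₀ : ℕ}
    (h : ∀ n, N₀ ≤ n → ⌊completeQuotient x n⌋ = 1) :
    FrequentlyApprox x √5 := by
  apply FrequentlyApprox.of_convergents hx
  intro N
  have hφ := Real.one_lt_goldenRatio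
  have hφ' := goldenRatio_mul_sub_one
  have h5 : √5 = 2 * Real.goldenRatio - 1 := by rw [Real.goldenRatio]; ring
  have hX : ∀ n, N₀ ≤ n → completeQuotient x n = Real.goldenRatio := fun n hn =>
    completeQuotient_eq_goldenRatio hx h hn
  set φ := Real.goldenRatio
  set n := max N N₀
  -- Since √5 = φ + (φ - 1), the index n works when q'/q ≥ φ - 1 = 1/φ. Otherwise q + q' < qφ, so
  -- the next ratio q/(q + q') exceeds 1/φ.
  by_cases hc : convDen x (n + 1) * (φ - 1) ≤ convDen x n
  · refine ⟨n, le_max_left _ _, ?_⟩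
    rw [hX (n + 1) (by omega), h5]
    linarith
  · refine ⟨n + 1, by omega, ?_⟩
    have hQ : (convDen x (n + 1 + 1) : ℝ) = convDen x (n + 1) + convDen x n := by
      rw [convDen, h (n + 1) (by omega)]
      push_cast
      ring
    rw [hX (n + 1 + 1) (by omega), h5, hQ]
    push Not at hc
    have hA : (convDen x (n + 1) : ℝ) * (φ * (φ - 1)) = convDen x (n + 1) := by rw [hφ', mul_one]
    linarith [mul_lt_mul_of_pos_right hc (by linarith : 0 < φ - 1)]

theorem frequentlyApprox_sqrt_five (hx : Irrational x) : FrequentlyApprox x √5 := by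
  by_cases h : ∃ N, ∀ n, N ≤ n → ⌊completeQuotient x n⌋ = 1
  · obtain ⟨N, h⟩ := h
    exact frequentlyApprox_sqrt_five_of_eventually_one hx h
  · push Not at h
    have := frequentlyApprox_of_two_le hx fun N => by
      obtain ⟨n, hn, h1⟩ := h (N + 1)
      obtain ⟨n, rfl⟩ := Nat.exists_eq_add_of_le' (show 1 ≤ n by omega)
      have := one_le_floor_completeQuotient_succ hx n
      exact ⟨n + 1, by omega, by omega⟩
    intro N
    obtain ⟨m, hm, hm0, h1⟩ := this N
    refine ⟨m, hm, hm0, le_trans ?_ h1⟩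
    have h2 : √5 ≤ 8 / 3 := by
      rw [Real.sqrt_le_left (by norm_num)]; norm_num
    have : 0 ≤ distInt (m * x) := abs_nonneg _
    gcongr

/-- A form of the norm inequality in `ℤ[φ]`: for nonzero `u φ + v`, the product with its conjugate
is at least `1` in absolute value. -/
theorem one_le_abs_norm {u v : ℤ} (h : u ≠ 0 ∨ v ≠ 0) :
    1 ≤ |u * Real.goldenRatio + v| * |u * Real.goldenRatio + v - u * √5| := by
  have h5 : √5 = 2 * Real.goldenRatio - 1 := by rw [Real.goldenRatio]; ring
  have h1 : (u * Real.goldenRatio + v) * (u * Real.goldenRatio + v - u * √5) =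
      ((v ^ 2 + u * v - u ^ 2 : ℤ) : ℝ) := by
    rw [h5]; push_cast
    linear_combination (-u ^ 2 : ℝ) * Real.goldenRatio_sq
  rw [← abs_mul, h1, ← Int.cast_abs]
  norm_cast
  apply Int.one_le_abs
  intro h0
  have h2 : (u * Real.goldenRatio + v) * (u * Real.goldenRatio + v - u * √5) = 0 := by
    rw [h1, h0, Int.cast_zero]
  have key : ∀ w : ℤ, (u * Real.goldenRatio : ℝ) = w → False := by
    intro w hw
    rcases eq_or_ne u 0 with rfl | hu
    · simp at h0; omega
    · exact (Real.goldenRatio_irrational.intCast_mul hu).ne_int w hw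
  rcases mul_eq_zero.1 h2 with h2 | h2
  · exact key (-v) (by push_cast; linarith)
  · exact key (u + v) (by push_cast; rw [h5] at h2; linear_combination -h2)

/-- Here x = (pφ + p')/D with D = qφ + q', so (mx - P)D lies in ℤ[φ] and its norm is at least 1 in
absolute value. Its conjugate has size at most about √5 m / D, which bounds ‖mx‖ from below. -/
theorem exists_le_distInt_of_eventually_one (hx : Irrational x) {N : ℕ}
    (h : ∀ n, N ≤ n → ⌊completeQuotient x n⌋ = 1) :
    ∃ C : ℝ, 0 ≤ C ∧ ∀ m : ℕ, 0 < m → m ≤ m * distInt (m * x) * (√5 * m + C) := by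
  have hX := completeQuotient_eq_goldenRatio hx h (n := N + 1) (by omega)
  have hd := det_conv x N
  have hm := mul_conv_eq hx N
  rw [hX] at hm
  obtain ⟨h0, -, h1⟩ := convDen_bounds hx N
  set p := convNum x (N + 1)
  set p' := convNum x N
  set q := convDen x (N + 1)
  set q' := convDen x N
  set φ := Real.goldenRatio
  have hφ : 1 < φ := Real.one_lt_goldenRatio
  have hq : (1 : ℝ) ≤ q := by exact_mod_cast h1
  have hq' : (0 : ℝ) ≤ q' := by exact_mod_cast h0
  set D : ℝ := q * φ + q'
  have hD : 1 ≤ D := by nlinarith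
  refine ⟨D * D + √5 * (q * D), by positivity, fun m hm0 => ?_⟩
  set P := round (m * x)
  obtain ⟨η, hη⟩ : ∃ η : ℝ, η = (m * x - P) * D := ⟨_, rfl⟩
  set u : ℤ := m * p - P * q with hu
  set v : ℤ := m * p' - P * q' with hv
  have huv : (u * φ + v : ℝ) = η := by
    rw [hη, hu, hv]; push_cast
    linear_combination (-m : ℝ) * hm
  have hmu : (m : ℤ) * (-1) ^ (N + 1) = u * q' - v * q := by
    rw [← hd]; ring
  have hmu' : (m * (-1) ^ (N + 1) : ℝ) = u * q' - v * q := by exact_mod_cast hmu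
  have hne : u ≠ 0 ∨ v ≠ 0 := by
    by_contra! hc
    rw [hc.1, hc.2] at hmu
    simp at hmu
    omega
  have hnorm := one_le_abs_norm hne
  rw [huv] at hnorm
  have hη1 : |η| = distInt (m * x) * D := by
    rw [hη, abs_mul, abs_of_pos (by linarith : 0 < D)]; rfl
  have hd0 : 0 ≤ distInt (m * x) := abs_nonneg _
  have hη2 : |η| ≤ D := by
    rw [hη1]; nlinarith [distInt_le_half (m * x)]
  -- The determinant ±1 shows that uD is ±m up to the bounded error qη. Hence the conjugate η - u√5
  -- has leading size √5 m / D.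
  have huD : u * D = m * (-1) ^ (N + 1) + q * η := by
    rw [hmu', ← huv]; ring
  have huD' : |(u : ℝ)| * D ≤ m + q * D := by
    calc |(u : ℝ)| * D = |(u : ℝ) * D| := by rw [abs_mul, abs_of_pos (by linarith : 0 < D)]
      _ ≤ |(m * (-1) ^ (N + 1) : ℝ)| + |q * η| := by rw [huD]; exact abs_add_le _ _
      _ = m + q * |η| := by
        simp [abs_mul, abs_of_nonneg (by linarith : (0 : ℝ) ≤ q)]
      _ ≤ _ := by gcongr
  have hconj : |η - u * √5| ≤ |η| + |(u : ℝ)| * √5 := by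
    calc |η - u * √5| ≤ |η| + |u * √5| := abs_sub _ _
      _ = _ := by rw [abs_mul, abs_of_nonneg (Real.sqrt_nonneg 5)]
  have hfin : 1 ≤ distInt (m * x) * (√5 * m + (D * D + √5 * (q * D))) := by
    calc 1 ≤ |η| * |η - u * √5| := hnorm
      _ ≤ |η| * (|η| + |(u : ℝ)| * √5) := by gcongr
      _ = distInt (m * x) * (D * |η| + √5 * (|(u : ℝ)| * D)) := by rw [hη1]; ring
      _ ≤ distInt (m * x) * (D * D + √5 * (m + q * D)) := by gcongr
      _ = _ := by ring
  have : (0 : ℝ) ≤ m := by positivity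
  nlinarith

/-! ### Abelian powers of an infinite word -/

section Words

variable {A : Type*}

theorem length_factorAt (s : ℕ → A) (n l : ℕ) : (factorAt s n l).length = l := by
  simp [factorAt]

theorem isFactor_factorAt (s : ℕ → A) (n l : ℕ) : IsFactor (factorAt s n l) s :=
  ⟨n, by rw [length_factorAt]⟩

theorem factorAt_add (s : ℕ → A) (n k l : ℕ) :
    factorAt s n (k + l) = factorAt s n k ++ factorAt s (n + k) l := by
  simp [factorAt, List.range_add, add_assoc]

theorem flatten_factorAt (s : ℕ → A) (n m k : ℕ) :
    ((List.range k).map fun i => factorAt s (n + i * m) m).flatten = factorAt s n (k * m) := by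
  induction k with
  | zero => simp [factorAt]
  | succ k ih => rw [List.range_succ, List.map_append, List.flatten_append, ih, add_mul, one_mul,
      factorAt_add]; simp

theorem IsFactor.of_append_append {u v w : List A} {s : ℕ → A} (h : IsFactor (u ++ v ++ w) s) :
    IsFactor v s := by
  obtain ⟨n, h⟩ := h
  refine ⟨n + u.length, ?_⟩
  rw [List.length_append, List.length_append, factorAt_add, factorAt_add] at h
  have h1 := List.append_inj_left h (by simp [length_factorAt])
  exact List.append_inj_right h1 (by simp [length_factorAt])

variable [DecidableEq A]

theorem count_flatten_of_parikh {blocks : List (List A)} {P : A → ℕ}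
    (h : ∀ u ∈ blocks, parikh u = P) (c : A) :
    blocks.flatten.count c = blocks.length * P c := by
  induction blocks with
  | nil => simp
  | cons u t ih =>
    rw [List.flatten_cons, List.count_append, ih fun v hv => h v (List.mem_cons_of_mem _ hv),
      List.length_cons, ← h u List.mem_cons_self, parikh]
    ring

variable [Fintype A]

theorem parikhNorm_parikh (w : List A) : parikhNorm (parikh w) = w.length := by
  simp only [parikhNorm, parikh]
  simpa using Multiset.sum_count_eq_card (s := Finset.univ) (m := (w : Multiset A)) (by simp)

theorem length_flatten_of_parikh {blocks : List (List A)} {P : A → ℕ}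
    (h : ∀ u ∈ blocks, parikh u = P) :
    blocks.flatten.length = blocks.length * parikhNorm P := by
  induction blocks with
  | nil => simp
  | cons u t ih =>
    rw [List.flatten_cons, List.length_append, ih fun v hv => h v (List.mem_cons_of_mem _ hv),
      ← parikhNorm_parikh u, h u List.mem_cons_self, List.length_cons]
    ring

theorem parikhContained_nil {P : A → ℕ} (h : 0 < parikhNorm P) :
    ParikhContained (parikh ([] : List A)) P :=
  ⟨by rwa [parikhNorm_parikh], fun a => by simp [parikh]⟩

theorem le_maxPowerExponent {s : ℕ → A} {m k : ℕ} (n : ℕ) (hm : 0 < m) (hk : 0 < k)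
    (h : ∀ i < k, parikh (factorAt s (n + i * m) m) = parikh (factorAt s n m)) :
    (k : ℝ≥0∞) ≤ maxPowerExponent s m := by
  apply le_sSup
  have hN : parikhNorm (parikh (factorAt s n m)) = m := by
    rw [parikhNorm_parikh, length_factorAt]
  refine ⟨factorAt s n (k * m), isFactor_factorAt _ _ _,
    ⟨(List.range k).map fun i => factorAt s (n + i * m) m, ?_, ?_, parikh (factorAt s n m), hN,
      ?_, parikhContained_nil (by omega), parikhContained_nil (by omega)⟩, ?_⟩
  · simp [flatten_factorAt]
  · simpa using Nat.succ_le_of_lt hk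
  · simpa using h
  · rw [exponent, length_factorAt, Nat.cast_mul, ENNReal.mul_div_cancel_right] <;> simp [hm.ne']

/-- Dropping the head and the tail, each shorter than m, leaves an abelian power. -/
theorem maxRepetitionExponent_le_add_two (s : ℕ → A) (m : ℕ) :
    maxRepetitionExponent s m ≤ maxPowerExponent s m + 2 := by
  apply sSup_le
  rintro _ ⟨w, hw, ⟨head, blocks, tail, ⟨rfl, h1, P, hP, hb, hh, ht⟩, -⟩, rfl⟩
  have hm : 0 < m := by have := hh.1; omega
  have h2 : exponent blocks.flatten m ≤ maxPowerExponent s m :=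
    le_sSup ⟨_, hw.of_append_append, ⟨blocks, by simp, h1, P, hP, hb,
      parikhContained_nil (by omega), parikhContained_nil (by omega)⟩, rfl⟩
  refine le_trans ?_ (add_le_add_left h2 2)
  have h3 := hh.1
  have h4 := ht.1
  rw [parikhNorm_parikh, hP] at h3 h4
  have h5 : ((2 * m : ℕ) : ℝ≥0∞) / m = 2 := by
    rw [Nat.cast_mul, ENNReal.mul_div_cancel_right] <;> simp [hm.ne']
  rw [← h5, exponent, exponent, ← ENNReal.add_div]
  apply ENNReal.div_le_div_right
  norm_cast
  simp only [List.length_append]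
  omega

/-- A power with at least two blocks is a repetition with empty ends. A single block has exponent at
most 1. -/
theorem maxPowerExponent_le_add_one (s : ℕ → A) (m : ℕ) :
    maxPowerExponent s m ≤ maxRepetitionExponent s m + 1 := by
  apply sSup_le
  rintro _ ⟨w, hw, ⟨blocks, hd⟩, rfl⟩
  by_cases h2 : 2 ≤ blocks.length
  · exact le_add_of_le_left (le_sSup ⟨w, hw, ⟨_, _, _, hd, h2⟩, rfl⟩)
  · obtain ⟨rfl, h1, P, hP, hb, hh, -⟩ := hd
    have h3 := length_flatten_of_parikh hb
    have h4 : blocks.length = 1 := by omega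
    refine le_trans ?_ le_add_self
    simp only [List.nil_append, List.append_nil, exponent, h3, h4, one_mul, hP]
    exact ENNReal.div_self_le_one

theorem limsup_div_le {f g : ℕ → ℝ≥0∞} {c : ℝ≥0∞} (hc : c ≠ ∞) (h : ∀ m, f m ≤ g m + c) :
    Filter.limsup (fun m : ℕ => f m / (m : ℝ≥0∞)) Filter.atTop ≤
      Filter.limsup (fun m : ℕ => g m / (m : ℝ≥0∞)) Filter.atTop := by
  apply le_of_forall_gt_imp_ge_of_dense
  intro a ha
  obtain ⟨b, hb, hba⟩ := exists_between ha
  have h1 : ∀ᶠ m : ℕ in Filter.atTop, c / (m : ℝ≥0∞) < a - b := by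
    have : Filter.Tendsto (fun m : ℕ => c / (m : ℝ≥0∞)) Filter.atTop (nhds 0) := by
      simp only [div_eq_mul_inv]
      simpa using ENNReal.Tendsto.const_mul ENNReal.tendsto_inv_nat_nhds_zero (Or.inr hc)
    exact this.eventually_lt_const (tsub_pos_of_lt hba)
  apply Filter.limsup_le_of_le (by isBoundedDefault)
  filter_upwards [h1, Filter.eventually_lt_of_limsup_lt hb] with m h1 h2
  calc f m / m ≤ (g m + c) / m := ENNReal.div_le_div_right (h m) _
    _ = g m / m + c / m := ENNReal.add_div
    _ ≤ b + (a - b) := add_le_add h2.le h1.le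
    _ = a := add_tsub_cancel_of_le hba.le

theorem abelianCriticalExponent_eq (s : ℕ → A) :
    abelianCriticalExponent s = abelianCriticalExponent' s :=
  le_antisymm (limsup_div_le ENNReal.one_ne_top (maxPowerExponent_le_add_one s))
    (limsup_div_le ENNReal.ofNat_ne_top (maxRepetitionExponent_le_add_two s))

end Words

/-! ### Abelian powers of Sturmian words -/

/-- `g` differs from the sequence `ρ + n α` by a rounding process which is constant between
consecutive integers. -/
structure IsRounding (α ρ : ℝ) (g : ℕ → ℤ) : Prop where
  abs_lt : ∀ i j : ℕ, |(g j - g i - (j - i) * α : ℝ)| < 1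
  eq_add : ∃ c : ℤ, ∀ (n : ℕ) (t : ℤ), (t : ℝ) < ρ + n * α → ρ + n * α < t + 1 → g n = t + c

theorem isRounding_floor (α ρ : ℝ) : IsRounding α ρ fun n => ⌊ρ + n * α⌋ := by
  constructor
  · intro i j
    have h1 := Int.floor_le (ρ + i * α)
    have h2 := Int.floor_le (ρ + j * α)
    have h3 := Int.lt_floor_add_one (ρ + i * α)
    have h4 := Int.lt_floor_add_one (ρ + j * α)
    rw [_root_.abs_lt]
    constructor <;> linarith
  · exact ⟨0, fun n t h1 h2 => by simpa using Int.floor_eq_iff.2 ⟨h1.le, h2⟩⟩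

theorem isRounding_ceil (α ρ : ℝ) : IsRounding α ρ fun n => ⌈ρ + n * α⌉ := by
  constructor
  · intro i j
    have h1 := Int.le_ceil (ρ + i * α)
    have h2 := Int.le_ceil (ρ + j * α)
    have h3 := Int.ceil_lt_add_one (ρ + i * α)
    have h4 := Int.ceil_lt_add_one (ρ + j * α)
    rw [_root_.abs_lt]
    constructor <;> linarith
  · exact ⟨1, fun n t h1 h2 => Int.ceil_eq_iff.2 ⟨by push_cast; linarith, by push_cast; linarith⟩⟩

theorem floor_add_eq {α y : ℝ} (hα : α ∈ Set.Ico (0 : ℝ) 1) :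
    ⌊y + α⌋ = ⌊y⌋ + if Int.fract y ∈ Set.Ico 0 (1 - α) then 0 else 1 := by
  have h1 := Int.fract_nonneg y
  have h2 := Int.fract_lt_one y
  have h3 := Int.floor_add_fract y
  obtain ⟨h4, h5⟩ := hα
  rw [Int.floor_eq_iff]
  split_ifs with h
  · have := h.2
    push_cast
    constructor <;> linarith
  · have : 1 - α ≤ Int.fract y := by by_contra! hc; exact h ⟨h1, hc⟩
    push_cast
    constructor <;> linarith

/-- Positivity of α matters when y is an integer: the ceiling then jumps, in agreement with 0
belonging to I_a in the upper coding. -/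
theorem ceil_add_eq {α y : ℝ} (hα : α ∈ Set.Ioo (0 : ℝ) 1) :
    ⌈y + α⌉ = ⌈y⌉ + if Int.fract y ∈ Set.Ioc 0 (1 - α) then 0 else 1 := by
  have h1 := Int.fract_nonneg y
  have h2 := Int.fract_lt_one y
  have h3 := Int.floor_add_fract y
  obtain ⟨h4, h5⟩ := hα
  rcases h1.eq_or_lt with h0 | h0
  · have hy : y = ⌊y⌋ := by linarith
    rw [← h0, if_neg (by simp), hy, Int.ceil_intCast, Int.ceil_eq_iff]
    push_cast
    constructor <;> linarith
  · have hc : ⌈y⌉ = ⌊y⌋ + 1 := by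
      rw [Int.ceil_eq_iff]; push_cast
      constructor <;> linarith
    rw [hc, Int.ceil_eq_iff]
    split_ifs with h
    · have := h.2
      push_cast
      constructor <;> linarith
    · have : 1 - α < Int.fract y := by by_contra! hc; exact h ⟨h0, hc⟩
      push_cast
      constructor <;> linarith

/-- From here on the two codings are treated alike: the floor serves the lower one, the ceiling the
upper one. -/
theorem IsSturmianWord.exists_isRounding {α ρ : ℝ} {s : ℕ → Letter} (h : IsSturmianWord α ρ s) :
    ∃ g : ℕ → ℤ, IsRounding α ρ g ∧ ∀ n, g (n + 1) = g n + if s n = Letter.a then 1 else 0 := by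
  obtain ⟨hα, hα1, -, rfl | rfl⟩ := h
  · refine ⟨_, isRounding_floor α ρ, fun n => ?_⟩
    have : ρ + ((n + 1 : ℕ) : ℝ) * α = ρ + n * α + α := by push_cast; ring
    rw [this, floor_add_eq hα1, lowerSturmian]
    split_ifs <;> simp_all
  · refine ⟨_, isRounding_ceil α ρ, fun n => ?_⟩
    have : ρ + ((n + 1 : ℕ) : ℝ) * α = ρ + n * α + α := by push_cast; ring
    rw [this, ceil_add_eq ⟨lt_of_le_of_ne hα1.1 hα.ne_zero.symm, hα1.2⟩, upperSturmian]
    split_ifs <;> simp_all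

theorem count_factorAt {s : ℕ → Letter} {g : ℕ → ℤ}
    (hg : ∀ n, g (n + 1) = g n + if s n = Letter.a then 1 else 0) (n l : ℕ) :
    ((factorAt s n l).count Letter.a : ℤ) = g (n + l) - g n := by
  induction l with
  | zero => simp [factorAt]
  | succ l ih =>
    rw [factorAt_add, List.count_append, Nat.cast_add, ih, ← add_assoc, hg (n + l)]
    have : factorAt s (n + l) 1 = [s (n + l)] := by simp [factorAt]
    rw [this, List.count_singleton]
    split_ifs <;> simp_all
    ring

theorem parikh_eq_of_count_eq {u v : List Letter} (hl : u.length = v.length)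
    (h : u.count Letter.a = v.count Letter.a) : parikh u = parikh v := by
  have hu := parikhNorm_parikh u
  have hv := parikhNorm_parikh v
  have huniv : (Finset.univ : Finset Letter) = {Letter.a, Letter.b} := rfl
  rw [parikhNorm, huniv, Finset.sum_pair (by simp)] at hu hv
  simp only [parikh] at hu hv
  funext c
  cases c
  · exact h
  · simp only [parikh]; omega

/-- Multiples of an irrational are dense in ℝ/ℤ; the integer t lifts the visit back to ℝ. -/
theorem exists_mem_Ioo_orbit {α : ℝ} (hα : Irrational α) (ρ : ℝ) {u v : ℝ} (huv : u < v) :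
    ∃ (n : ℕ) (t : ℤ), t + u < ρ + n * α ∧ ρ + n * α < t + v := by
  have hd : DenseRange (· • (α : AddCircle (1 : ℝ)) : ℕ → AddCircle (1 : ℝ)) := by
    rw [← denseRange_zsmul_iff_nsmul, AddCircle.denseRange_zsmul_coe_iff, div_one]
    exact hα
  have hopen : IsOpen ((fun y : ℝ => (y : AddCircle (1 : ℝ))) '' Set.Ioo (u - ρ) (v - ρ)) :=
    QuotientAddGroup.isOpenMap_coe _ isOpen_Ioo
  obtain ⟨n, y, hy, hyn⟩ := hd.exists_mem_open hopen
    ((Set.nonempty_Ioo.2 (by linarith)).image _)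
  simp only at hyn
  rw [← AddCircle.coe_nsmul, eq_comm, ← sub_eq_zero, ← AddCircle.coe_sub,
    AddCircle.coe_eq_zero_iff] at hyn
  obtain ⟨t, ht⟩ := hyn
  refine ⟨n, t, ?_, ?_⟩ <;> simp at ht <;> linarith [hy.1, hy.2]

theorem maxPowerExponent_le {α ρ : ℝ} {s : ℕ → Letter} (h : IsSturmianWord α ρ s) {m : ℕ}
    (hm : 0 < m) : maxPowerExponent s m ≤ ENNReal.ofReal (1 / distInt (m * α)) := by
  obtain ⟨g, hr, hg⟩ := h.exists_isRounding
  apply sSup_le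
  rintro _ ⟨w, ⟨n, hw⟩, ⟨blocks, hwb, -, P, hP, hb, -, -⟩, rfl⟩
  rw [List.nil_append, List.append_nil] at hwb
  have hl : w.length = blocks.length * m := by rw [hwb, length_flatten_of_parikh hb, hP]
  have hc : ((blocks.length * P Letter.a : ℕ) : ℤ) = g (n + blocks.length * m) - g n := by
    rw [← count_factorAt hg, ← hl, ← hw, hwb, count_flatten_of_parikh hb]
  have he : exponent w m = blocks.length := by
    rw [exponent, hl, Nat.cast_mul, ENNReal.mul_div_cancel_right] <;> simp [hm.ne']
  have h1 := hr.abs_lt n (n + blocks.length * m)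
  set k := blocks.length
  have hc' : ((k * P Letter.a : ℕ) : ℝ) = g (n + k * m) - g n := by exact_mod_cast hc
  rw [← hc'] at h1
  rw [he, ← ENNReal.ofReal_natCast]
  apply ENNReal.ofReal_le_ofReal
  rw [le_div_iff₀ (distInt_pos h.1 hm)]
  calc (k : ℝ) * distInt (m * α) ≤ k * |m * α - (P Letter.a : ℤ)| := by
        gcongr; exact round_le _ _
    _ = |((k * P Letter.a : ℕ) : ℝ) - ((n + k * m : ℕ) - n) * α| := by
        have e : ((k * P Letter.a : ℕ) : ℝ) - ((n + k * m : ℕ) - n) * α =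
            -(k * (m * α - (P Letter.a : ℤ))) := by push_cast; ring
        rw [e, abs_neg, abs_mul, Nat.abs_cast]
    _ ≤ 1 := h1.le

theorem le_maxPowerExponent_of_mul_lt_one {α ρ : ℝ} {s : ℕ → Letter} (h : IsSturmianWord α ρ s)
    {m k : ℕ} (hm : 0 < m) (hk : 0 < k) (hlt : k * distInt (m * α) < 1) :
    (k : ℝ≥0∞) ≤ maxPowerExponent s m := by
  obtain ⟨g, hr, hg⟩ := h.exists_isRounding
  obtain ⟨c, hc⟩ := hr.eq_add
  obtain ⟨D, hD⟩ : ∃ D : ℝ, D = m * α - round (m * α) := ⟨_, rfl⟩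
  have hDk : k * (max 0 D + max 0 (-D)) < 1 := by
    convert hlt using 2
    rw [distInt, ← hD, max_comm 0, max_comm 0, max_zero_add_max_neg_zero_eq_abs_self]
  -- D is the signed drift of the orbit per block, modulo 1. The margins leave room for k drifts in
  -- either direction, and the interval is nonempty because k|D| < 1.
  obtain ⟨n, t, h1, h2⟩ := exists_mem_Ioo_orbit h.1 ρ
    (u := k * max 0 (-D)) (v := 1 - k * max 0 D) (by linarith)
  have hgi : ∀ i ≤ k, g (n + i * m) = t + c + i * round (m * α) := by
    intro i hi
    have hi' : (i : ℝ) ≤ k := by exact_mod_cast hi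
    have e : ρ + ((n + i * m : ℕ) : ℝ) * α = ρ + n * α + i * D + i * round (m * α) := by
      rw [hD]; push_cast; ring
    have b1 : i * D ≤ k * max 0 D := by
      exact (mul_le_mul_of_nonneg_left (le_max_right 0 D) (by positivity)).trans
        (mul_le_mul_of_nonneg_right hi' (le_max_left 0 D))
    have b2 : i * (-D) ≤ k * max 0 (-D) := by
      exact (mul_le_mul_of_nonneg_left (le_max_right 0 (-D)) (by positivity)).trans
        (mul_le_mul_of_nonneg_right hi' (le_max_left 0 (-D)))
    rw [hc (n + i * m) (t + i * round (m * α))]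
    · ring
    · rw [e]; push_cast; linarith
    · rw [e]; push_cast; linarith
  have hcount : ∀ i < k, ((factorAt s (n + i * m) m).count Letter.a : ℤ) = round (m * α) := by
    intro i hi
    have := hgi (i + 1) hi
    rw [count_factorAt hg, hgi i hi.le, show n + i * m + m = n + (i + 1) * m by ring, this]
    push_cast; ring
  refine le_maxPowerExponent n hm hk fun i hi => parikh_eq_of_count_eq ?_ ?_
  · simp only [length_factorAt]
  · have h0 := hcount 0 hk
    rw [zero_mul, add_zero] at h0
    exact_mod_cast (hcount i hi).trans h0.symm

theorem ofReal_sub_one_le_maxPowerExponent {α ρ : ℝ} {s : ℕ → Letter} (h : IsSturmianWord α ρ s)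
    {m : ℕ} (hm : 0 < m) :
    ENNReal.ofReal (1 / distInt (m * α) - 1) ≤ maxPowerExponent s m := by
  have hpos := distInt_pos h.1 hm
  have h2 : 2 ≤ 1 / distInt (m * α) := by
    rw [le_div_iff₀ hpos]; linarith [distInt_le_half (m * α)]
  -- This k is the largest integer strictly below 1/‖mα‖, and is positive because ‖mα‖ ≤ 1/2.
  obtain ⟨k, hk⟩ : ∃ k, ⌈1 / distInt (m * α)⌉₊ = k + 1 :=
    Nat.exists_eq_succ_of_ne_zero (Nat.ceil_pos.2 (by linarith)).ne'
  have h3 := Nat.le_ceil (1 / distInt (m * α))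
  have h4 := Nat.ceil_lt_add_one (show 0 ≤ 1 / distInt (m * α) by linarith)
  rw [hk] at h3 h4
  push_cast at h3 h4
  refine le_trans ?_ (le_maxPowerExponent_of_mul_lt_one h hm (k := k) ?_ ?_)
  · rw [← ENNReal.ofReal_natCast]
    exact ENNReal.ofReal_le_ofReal (by linarith)
  · have : (0 : ℝ) < k := by linarith
    exact_mod_cast this
  · rw [← lt_div_iff₀ hpos]; linarith

theorem FrequentlyApprox.ofReal_le {α ρ c : ℝ} {s : ℕ → Letter} (h : IsSturmianWord α ρ s)
    (hc : FrequentlyApprox α c) : ENNReal.ofReal c ≤ abelianCriticalExponent s := by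
  have h1 : Filter.Tendsto (fun N : ℕ => ENNReal.ofReal (c - 1 / ((N : ℝ) + 1))) Filter.atTop
      (nhds (ENNReal.ofReal c)) := by
    apply ENNReal.tendsto_ofReal
    simpa using tendsto_one_div_add_atTop_nhds_zero_nat.const_sub c
  -- The loss of 1 in k_m costs 1/m ≤ 1/(N + 1) after division by m; N then tends to infinity.
  refine le_of_tendsto h1 (Filter.Eventually.of_forall fun N => ?_)
  apply Filter.le_limsup_of_frequently_le
  · rw [Filter.frequently_atTop]
    intro M
    obtain ⟨m, hm, hm0, hle⟩ := hc (max M (N + 1))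
    refine ⟨m, (le_max_left _ _).trans hm, ?_⟩
    have hm' : (0 : ℝ) < m := by exact_mod_cast hm0
    have hN : (N + 1 : ℝ) ≤ m := by exact_mod_cast (le_max_right _ _).trans hm
    have hpos := distInt_pos h.1 hm0
    calc ENNReal.ofReal (c - 1 / ((N : ℝ) + 1))
        ≤ ENNReal.ofReal ((1 / distInt (m * α) - 1) / m) := by
          apply ENNReal.ofReal_le_ofReal
          rw [sub_div, div_div]
          apply sub_le_sub
          · rw [le_div_iff₀ (by positivity)]; linarith
          · gcongr
      _ = ENNReal.ofReal (1 / distInt (m * α) - 1) / m := by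
          rw [ENNReal.ofReal_div_of_pos hm', ENNReal.ofReal_natCast]
      _ ≤ _ := ENNReal.div_le_div_right (ofReal_sub_one_le_maxPowerExponent h hm0) _
  · isBoundedDefault

theorem abelianCriticalExponent_le_of_eventually_one {α ρ : ℝ} {s : ℕ → Letter}
    (h : IsSturmianWord α ρ s) {N : ℕ} (hN : ∀ n, N ≤ n → ⌊completeQuotient α n⌋ = 1) :
    abelianCriticalExponent s ≤ ENNReal.ofReal √5 := by
  obtain ⟨C, hC, hle⟩ := exists_le_distInt_of_eventually_one h.1 hN
  have h1 : Filter.Tendsto (fun m : ℕ => ENNReal.ofReal (√5 + C / m)) Filter.atTop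
      (nhds (ENNReal.ofReal √5)) := by
    apply ENNReal.tendsto_ofReal
    simpa using (tendsto_const_div_atTop_nhds_zero_nat C).const_add √5
  rw [← h1.limsup_eq]
  apply Filter.limsup_le_limsup
  · filter_upwards [Filter.eventually_gt_atTop 0] with m hm
    have hm' : (0 : ℝ) < m := by exact_mod_cast hm
    have hpos := distInt_pos h.1 hm
    calc maxPowerExponent s m / m ≤ ENNReal.ofReal (1 / distInt (m * α)) / m :=
          ENNReal.div_le_div_right (maxPowerExponent_le h hm) _
      _ = ENNReal.ofReal (1 / distInt (m * α) / m) := by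
          rw [ENNReal.ofReal_div_of_pos hm', ENNReal.ofReal_natCast]
      _ ≤ _ := by
          apply ENNReal.ofReal_le_ofReal
          rw [div_div, div_le_iff₀ (by positivity)]
          have h2 := hle m hm
          have h3 : (√5 + C / m) * (distInt (m * α) * m) =
            distInt (m * α) * (√5 * m + C) := by field_simp
          rw [h3]
          by_contra! hc
          nlinarith
  · isBoundedDefault
  · isBoundedDefault

/-! ### Equivalence with the golden ratio -/

theorem irrational_goldenRatio_sub_one : Irrational (Real.goldenRatio - 1) := by
  simpa using Real.goldenRatio_irrational.sub_natCast 1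

theorem floor_goldenRatio : ⌊Real.goldenRatio⌋ = 1 := by
  rw [Int.floor_eq_iff]
  have := Real.one_lt_goldenRatio
  have := Real.goldenRatio_lt_two
  push_cast
  constructor <;> linarith

theorem completeQuotient_goldenRatio_sub_one (n : ℕ) :
    completeQuotient (Real.goldenRatio - 1) (n + 1) = Real.goldenRatio := by
  have hinv : (Real.goldenRatio - 1)⁻¹ = Real.goldenRatio :=
    inv_eq_of_mul_eq_one_left goldenRatio_mul_sub_one
  have hfr : Int.fract Real.goldenRatio = Real.goldenRatio - 1 := by
    rw [Int.fract, floor_goldenRatio, Int.cast_one]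
  induction n with
  | zero =>
    rw [completeQuotient, completeQuotient, Int.fract_sub_one, hfr, hinv]
  | succ n ih => rw [completeQuotient, ih, hfr, hinv]

theorem partialQuotient_goldenRatio_sub_one (n : ℕ) :
    partialQuotient (Real.goldenRatio - 1) (n + 1) = some 1 := by
  rw [partialQuotient_eq irrational_goldenRatio_sub_one, completeQuotient_goldenRatio_sub_one,
    floor_goldenRatio, Int.cast_one]

theorem cfEquivalent_goldenRatio_iff (x : ℝ) :
    CFEquivalent x (Real.goldenRatio - 1) ↔ ∃ N : ℕ, ∀ n, N ≤ n → partialQuotient x n = some 1 := by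
  constructor
  · rintro ⟨N, M, h⟩
    -- The extra 1 avoids the leading partial quotient of φ - 1, which is 0; the shift 1 in the
    -- converse does the same.
    refine ⟨N + 1, fun n hn => ?_⟩
    obtain ⟨i, rfl⟩ := Nat.exists_eq_add_of_le hn
    rw [add_assoc, add_comm 1 i, h, ← add_assoc, partialQuotient_goldenRatio_sub_one]
  · rintro ⟨N, h⟩
    refine ⟨N, 1, fun i => ?_⟩
    rw [h _ (by omega), add_comm 1 i, partialQuotient_goldenRatio_sub_one]

theorem partialQuotient_eq_one_iff {x : ℝ} (hx : Irrational x) (n : ℕ) :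
    partialQuotient x n = some 1 ↔ ⌊completeQuotient x n⌋ = 1 := by
  rw [partialQuotient_eq hx, Option.some_inj]
  norm_cast

theorem abelianCriticalExponent_eq_sqrt_five_iff {α ρ : ℝ} {s : ℕ → Letter}
    (h : IsSturmianWord α ρ s) :
    abelianCriticalExponent s = ENNReal.ofReal √5 ↔
      ∃ N : ℕ, ∀ n, N ≤ n → partialQuotient α n = some 1 := by
  simp only [partialQuotient_eq_one_iff h.1]
  constructor
  · intro heq
    by_contra! hne
    have h1 := (frequentlyApprox_of_two_le h.1 fun N => by
      -- Index 0 is skipped because ⌊α⌋ may be 0. At positive indices, a quotient other than 1 is at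
      -- least 2, so A(s) ≥ 8/3, contradicting 64/9 > 5.
      obtain ⟨n, hn, h1⟩ := hne (N + 1)
      obtain ⟨n, rfl⟩ := Nat.exists_eq_add_of_le' (show 1 ≤ n by omega)
      have := one_le_floor_completeQuotient_succ h.1 n
      exact ⟨n + 1, by omega, by omega⟩).ofReal_le h
    rw [heq, ENNReal.ofReal_le_ofReal_iff (Real.sqrt_nonneg 5),
      Real.le_sqrt' (by norm_num)] at h1
    norm_num at h1
  · rintro ⟨N, hN⟩
    exact le_antisymm (abelianCriticalExponent_le_of_eventually_one h hN)
      ((frequentlyApprox_sqrt_five h.1).ofReal_le h)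

theorem isSturmianWord_fibonacciWord :
    IsSturmianWord (Real.goldenRatio - 1) (Real.goldenRatio - 1) fibonacciWord := by
  have h : Real.goldenRatio - 1 ∈ Set.Ico (0 : ℝ) 1 :=
    ⟨by linarith [Real.one_lt_goldenRatio], by linarith [Real.goldenRatio_lt_two]⟩
  exact ⟨irrational_goldenRatio_sub_one, h, h, Or.inl rfl⟩

end AbelianSturmian

theorem mainTheorem7 :
    (∀ (α ρ : ℝ) (s : ℕ → AbelianSturmian.Letter), AbelianSturmian.IsSturmianWord α ρ s →
      AbelianSturmian.abelianCriticalExponent s = AbelianSturmian.abelianCriticalExponent' s ∧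
      ENNReal.ofReal (Real.sqrt 5) ≤ AbelianSturmian.abelianCriticalExponent s ∧
      (AbelianSturmian.abelianCriticalExponent s = ENNReal.ofReal (Real.sqrt 5) ↔
        AbelianSturmian.CFEquivalent α (Real.goldenRatio - 1)) ∧
      (AbelianSturmian.CFEquivalent α (Real.goldenRatio - 1) ↔
        ∃ N : ℕ, ∀ n : ℕ, N ≤ n → AbelianSturmian.partialQuotient α n = some 1)) ∧
    AbelianSturmian.abelianCriticalExponent AbelianSturmian.fibonacciWord =
      ENNReal.ofReal (Real.sqrt 5) := by
  refine ⟨fun α ρ s h => ⟨AbelianSturmian.abelianCriticalExponent_eq s,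
    (AbelianSturmian.frequentlyApprox_sqrt_five h.1).ofReal_le h, ?_,
    AbelianSturmian.cfEquivalent_goldenRatio_iff α⟩, ?_⟩
  · rw [AbelianSturmian.cfEquivalent_goldenRatio_iff,
      AbelianSturmian.abelianCriticalExponent_eq_sqrt_five_iff h]
  · rw [AbelianSturmian.abelianCriticalExponent_eq_sqrt_five_iff
      AbelianSturmian.isSturmianWord_fibonacciWord, ← AbelianSturmian.cfEquivalent_goldenRatio_iff]
    exact ⟨0, 0, fun _ => rfl⟩
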